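/- Let $R$ be a commutative ring, let $x = x_1,\dots,x_k$ be a finite sequence of elements of $R$, and for $n\ge 1$ put $x^{(n)} = x_1^n,\dots,x_k^n$. The sequence $x$ is called weakly proregular if for every $i>0$ and every $n\ge 1$ there is an $m\ge n$ such that the natural map of Koszul homology modules $H_i(x^{(m)};R)\to H_i(x^{(n)};R)$ (induced by $e_{j}\mapsto x_{j}^{m-n}e_{j}$ on Koszul complexes) is zero. For $y\in R$ let $L_y$ be the complex of free $R$-modules $R\oplus R[T]\to R[T]$, $(r,f)\mapsto r+(1-yT)f$, in cohomological degrees $0$ and $1$; it is a free resolution of the Čech complex $R\to R_y$. Put $L_x = L_{x_1}\otimes_R\cdots\otimes_R L_{x_k}$, a bounded free resolution of the Čech complex $\check C_x$, and for an $R$-module $M$ define the Čech homology $\check H^x_i(M) = H_i(\operatorname{Hom}_R(L_x,M))$. Let $E$ be an injective cogenerator in the category of $R$-modules. Then the following conditions are equivalent: (i) The sequence $x$ is weakly proregular. (ii) $\check H^x_i(\operatorname{Hom}_R(I,J))=0$ for all $i>0$ and all injective $R$-modules $I$ and $J$. (iii) $\check H^x_i(\operatorname{Hom}_R(I,E))=0$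 for all $i>0$ and all injective $R$-modules $I$. -/

import Mathlib

open CategoryTheory

universe u

noncomputable section

namespace CechKoszul


/-- The sign `(-1)^#{i ∈ S | i < j}` of exterior multiplication by, or contraction with, the
`j`-th basis vector. -/
def sgn {k : ℕ} (S : Finset (Fin k)) (j : Fin k) : ℤ :=
  (-1) ^ (S.filter (· < j)).card

lemma sgn_mul_sgn_insert {k : ℕ} {S : Finset (Fin k)} {j l : Fin k} (hj : j ∉ S) (hl : l ∉ S)
    (hjl : j ≠ l) :
    sgn S j * sgn (insert j S) l + sgn S l * sgn (insert l S) j = 0 := by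
  have aux : ∀ a b : Fin k, a ∉ S → a < b →
      sgn S a * sgn (insert a S) b + sgn S b * sgn (insert b S) a = 0 := by
    intro a b ha hab
    have h1 : ((insert a S).filter (· < b)).card = (S.filter (· < b)).card + 1 := by
      rw [Finset.filter_insert, if_pos hab, Finset.card_insert_of_notMem]
      simp [ha]
    have h2 : (insert b S).filter (· < a) = S.filter (· < a) := by
      rw [Finset.filter_insert, if_neg (not_lt.mpr hab.le)]
    simp only [sgn, h1, h2, pow_succ]
    ring
  rcases lt_or_gt_of_ne hjl with h | h
  · exact aux j l hj h
  · rw [add_comm]; exact aux l j hl h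

lemma sgn_erase {k : ℕ} (S : Finset (Fin k)) (j : Fin k) : sgn (S.erase j) j = sgn S j := by
  unfold sgn
  congr 2
  ext i
  simp only [Finset.mem_filter, Finset.mem_erase]
  constructor
  · rintro ⟨⟨_, h⟩, h'⟩; exact ⟨h, h'⟩
  · rintro ⟨h, h'⟩; exact ⟨⟨h'.ne, h⟩, h'⟩

section Koszul

variable {R : Type u} [CommRing R] {k : ℕ} {N : Type u} [AddCommGroup N] [Module R N]

/-- The degree `p` part `⋀^p (R^k) ⊗ N` of the Koszul complexes with coefficients in `N`: an
element is given by its coefficients at the `e_S`, with `S` a `p`-element subset of the index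
set. -/
abbrev KoszulTerm (k : ℕ) (N : Type u) (p : ℕ) : Type u :=
  {S : Finset (Fin k) // S.card = p} → N

/-- The Koszul boundary for a family `φ` of endomorphisms of `N`,
`n e_{j_0 ⋯ j_p} ↦ ∑_r (-1)^r φ_{j_r}(n) e_{j_0 ⋯ (omit j_r) ⋯ j_p}`, in coefficients. -/
def koszulBoundary (φ : Fin k → Module.End R N) (p : ℕ) :
    KoszulTerm k N (p + 1) →ₗ[R] KoszulTerm k N p where
  toFun f S := ∑ j : {j : Fin k // j ∉ S.1},
    sgn S.1 j.1 • φ j.1 (f ⟨insert j.1 S.1, by rw [Finset.card_insert_of_notMem j.2, S.2]⟩)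
  map_add' f g := by
    funext S
    simp [Finset.sum_add_distrib]
  map_smul' r f := by
    funext S
    simp [Finset.smul_sum, smul_comm r]

/-- The Koszul coboundary for a family `φ` of endomorphisms of `N`,
`n e_S ↦ ∑_{j ∉ S} φ_j(n) (e_j ∧ e_S)`, in coefficients. -/
def koszulCoboundary (φ : Fin k → Module.End R N) (p : ℕ) :
    KoszulTerm k N p →ₗ[R] KoszulTerm k N (p + 1) where
  toFun f S := ∑ j : {j : Fin k // j ∈ S.1},
    sgn S.1 j.1 • φ j.1 (f ⟨S.1.erase j.1, by rw [Finset.card_erase_of_mem j.2, S.2]; rfl⟩)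
  map_add' f g := by
    funext S
    simp [Finset.sum_add_distrib]
  map_smul' r f := by
    funext S
    simp [Finset.smul_sum, smul_comm r]

lemma koszulBoundary_comp (φ : Fin k → Module.End R N) (hφ : ∀ i j, Commute (φ i) (φ j))
    (p : ℕ) : koszulBoundary φ p ∘ₗ koszulBoundary φ (p + 1) = 0 := by
  refine LinearMap.ext fun f => ?_
  funext S
  simp only [koszulBoundary, LinearMap.comp_apply, LinearMap.coe_mk, AddHom.coe_mk, map_sum,
    Finset.smul_sum, LinearMap.zero_apply, Pi.zero_apply]
  rw [Finset.sum_sigma']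
  refine Finset.sum_involution
    (fun a _ => ⟨⟨a.2.1, fun h => a.2.2 (Finset.mem_insert_of_mem h)⟩,
      ⟨a.1.1, fun h => (Finset.mem_insert.mp h).elim
        (fun h' => a.2.2 (Finset.mem_insert.mpr (Or.inl h'.symm))) a.1.2⟩⟩) ?_ ?_ ?_ ?_
  · rintro ⟨⟨j, hj⟩, ⟨l, hl⟩⟩ _
    have hjl : j ≠ l := fun h => hl (by simp [h])
    have hl' : l ∉ S.1 := fun h => hl (Finset.mem_insert_of_mem h)
    have hc : ∀ n, φ j (φ l n) = φ l (φ j n) := fun n => LinearMap.congr_fun (hφ j l) n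
    simp only [map_zsmul, smul_smul, hc, Finset.insert_comm l j]
    rw [← add_smul, sgn_mul_sgn_insert hj hl' hjl, zero_smul]
  · rintro ⟨⟨j, hj⟩, ⟨l, hl⟩⟩ _ _ h
    have h1 := congrArg (fun a : Σ j : {j : Fin k // j ∉ S.1}, {l // l ∉ insert j.1 S.1} => a.1.1) h
    exact hl (by simp only at h1; simp [h1])
  · intros; exact Finset.mem_sigma.mpr ⟨Finset.mem_univ _, Finset.mem_univ _⟩
  · intros; rfl

lemma koszulCoboundary_comp (φ : Fin k → Module.End R N) (hφ : ∀ i j, Commute (φ i) (φ j))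
    (p : ℕ) : koszulCoboundary φ (p + 1) ∘ₗ koszulCoboundary φ p = 0 := by
  refine LinearMap.ext fun f => ?_
  funext S
  simp only [koszulCoboundary, LinearMap.comp_apply, LinearMap.coe_mk, AddHom.coe_mk, map_sum,
    Finset.smul_sum, LinearMap.zero_apply, Pi.zero_apply]
  rw [Finset.sum_sigma']
  refine Finset.sum_involution
    (fun a _ => ⟨⟨a.2.1, Finset.mem_of_mem_erase a.2.2⟩,
      ⟨a.1.1, Finset.mem_erase.mpr ⟨(Finset.ne_of_mem_erase a.2.2).symm, a.1.2⟩⟩⟩) ?_ ?_ ?_ ?_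
  · rintro ⟨⟨j, hj⟩, ⟨l, hl⟩⟩ _
    have hlj : l ≠ j := Finset.ne_of_mem_erase hl
    have hl' : l ∈ S.1 := Finset.mem_of_mem_erase hl
    have hc : ∀ n, φ j (φ l n) = φ l (φ j n) := fun n => LinearMap.congr_fun (hφ j l) n
    have key := sgn_mul_sgn_insert (S := (S.1.erase j).erase l) (j := j) (l := l)
      (by simp) (by simp) hlj.symm
    have e1 : insert j ((S.1.erase j).erase l) = S.1.erase l := by
      rw [Finset.erase_right_comm, Finset.insert_erase (Finset.mem_erase.mpr ⟨hlj.symm, hj⟩)]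
    have e2 : insert l ((S.1.erase j).erase l) = S.1.erase j := Finset.insert_erase hl
    rw [e1, e2, sgn_erase, sgn_erase, Finset.erase_right_comm, sgn_erase] at key
    rw [sgn_erase] at key
    simp only [map_zsmul, smul_smul, hc, Finset.erase_right_comm (a := l) (b := j)]
    rw [← add_smul]
    have : sgn S.1 j * sgn (S.1.erase j) l + sgn S.1 l * sgn (S.1.erase l) j = 0 := by
      linarith
    rw [this, zero_smul]
  · rintro ⟨⟨j, hj⟩, ⟨l, hl⟩⟩ _ _ h
    have h1 := congrArg (fun a : Σ j : {j : Fin k // j ∈ S.1}, {l // l ∈ S.1.erase j.1} => a.1.1) h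
    exact Finset.ne_of_mem_erase hl h1
  · intros; exact Finset.mem_sigma.mpr ⟨Finset.mem_univ _, Finset.mem_univ _⟩
  · intros; rfl

end Koszul

section WeaklyProregular

variable {R : Type u} [CommRing R] {k : ℕ}

/-- Multiplication by the elements of a sequence, as a family of endomorphisms of `M`. -/
def mulEnd (x : Fin k → R) (M : Type u) [AddCommGroup M] [Module R M] (j : Fin k) :
    Module.End R M :=
  LinearMap.lsmul R M (x j)

lemma mulEnd_commute (x : Fin k → R) (M : Type u) [AddCommGroup M] [Module R M] (i j : Fin k) :
    Commute (mulEnd x M i) (mulEnd x M j) := by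
  ext m
  simp [mulEnd, smul_comm (x i)]

/-- The Koszul complex `K_•(x; M)`. -/
def koszulComplex (x : Fin k → R) (M : Type u) [AddCommGroup M] [Module R M] :
    ChainComplex (ModuleCat.{u} R) ℕ :=
  ChainComplex.of (fun p => ModuleCat.of R (KoszulTerm k M p))
    (fun p => ModuleCat.ofHom (koszulBoundary (mulEnd x M) p))
    (fun p => by
      rw [← ModuleCat.ofHom_comp, koszulBoundary_comp _ (mulEnd_commute x M)]
      rfl)

/-- The degree `p` component of `K_•(x^(m); M) → K_•(x^(n); M)` for `n ≤ m`; it sends `e_S` to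
`(∏_{j ∈ S} x_j^(m - n)) e_S`. -/
def koszulPowHom (x : Fin k → R) (M : Type u) [AddCommGroup M] [Module R M] (m n p : ℕ) :
    KoszulTerm k M p →ₗ[R] KoszulTerm k M p :=
  LinearMap.pi fun S => (∏ j ∈ S.1, x j ^ (m - n)) • LinearMap.proj S

/-- The natural map `K_•(x^(m); M) → K_•(x^(n); M)` for `n ≤ m`, where
`x^(n) = x_1^n, …, x_k^n`. It is the tensor product over `j` of the maps
`K_•(x_j^m) → K_•(x_j^n)` given by the identity in degree `0` and by `x_j^(m - n)` in
degree `1`. -/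
def koszulPowMap (x : Fin k → R) (M : Type u) [AddCommGroup M] [Module R M] {n m : ℕ}
    (h : n ≤ m) :
    koszulComplex (fun j => x j ^ m) M ⟶ koszulComplex (fun j => x j ^ n) M :=
  ChainComplex.ofHom (fun p => ModuleCat.ofHom (koszulPowHom x M m n p)) (by
    intro p
    simp only [koszulComplex, ChainComplex.of, ChainComplex.of_d]
    rw [← ModuleCat.ofHom_comp, ← ModuleCat.ofHom_comp]
    congr 1
    refine LinearMap.ext fun f => ?_
    funext S
    simp only [koszulPowHom, koszulBoundary, mulEnd, LinearMap.comp_apply, LinearMap.coe_mk,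
      AddHom.coe_mk, LinearMap.pi_apply, LinearMap.smul_apply, LinearMap.proj_apply,
      LinearMap.lsmul_apply, Finset.smul_sum]
    refine Finset.sum_congr rfl fun j _ => ?_
    rw [Finset.prod_insert j.2, smul_comm _ (sgn S.1 j.1), smul_smul, smul_smul]
    congr 2
    rw [← mul_assoc, ← pow_add, Nat.add_sub_cancel' h, mul_comm])

/-- The sequence `x` is `M`-weakly proregular: for all `i > 0` and `n > 0` there is `m ≥ n` such
that the natural map `H_i(x^(m); M) → H_i(x^(n); M)` is zero. -/
def IsWeaklyProregularOn (x : Fin k → R) (M : Type u) [AddCommGroup M] [Module R M] : Prop :=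
  ∀ i : ℕ, 0 < i → ∀ n : ℕ, 0 < n → ∃ (m : ℕ) (h : n ≤ m),
    HomologicalComplex.homologyMap (koszulPowMap x M h) i = 0

/-- The sequence `x` in `R` is weakly proregular if it is `R`-weakly proregular. -/
def IsWeaklyProregular (x : Fin k → R) : Prop :=
  IsWeaklyProregularOn x R

end WeaklyProregular

section Cech

variable {R : Type u} [CommRing R] {k : ℕ}

/-- For one element `x` the Čech complex `R → R_x` (in degrees `0` and `1`) has the free
resolution `R ⊕ R[T] → R[T]`, `(r, f) ↦ r + (1 - x T) f`. Label the basis of its degree `0` part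
as `e_0 = (1, 0)`, `e_{n+1} = (0, T^n)` and that of its degree `1` part as `f_n = T^n`: the
differential is `e_0 ↦ f_0` and `e_{n+1} ↦ f_n - x f_{n+1}`, and the quasi-isomorphism to
`R → R_x` is `e_0 ↦ 1`, `e_{n+1} ↦ 0`, `f_n ↦ 1 / x^n`.

For a sequence of `k` elements one takes the tensor product of these `k` complexes. All its terms
are direct sums of copies of the free module on `ℕ^k`; this is the differential of the `j`-th
tensor factor. -/
def cechEnd (x : Fin k → R) (j : Fin k) : Module.End R ((Fin k → ℕ) →₀ R) :=
  Finsupp.linearCombination R fun a =>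
    if a j = 0 then Finsupp.single a 1
    else Finsupp.single (Function.update a j (a j - 1)) 1 - x j • Finsupp.single a 1

lemma cechEnd_single (x : Fin k → R) (j : Fin k) (a : Fin k → ℕ) :
    cechEnd x j (Finsupp.single a 1) =
      if a j = 0 then Finsupp.single a 1
      else Finsupp.single (Function.update a j (a j - 1)) 1 - x j • Finsupp.single a 1 := by
  simp [cechEnd]

lemma cechEnd_commute (x : Fin k → R) (i j : Fin k) :
    Commute (cechEnd x i) (cechEnd x j) := by
  rcases eq_or_ne i j with rfl | hij
  · exact Commute.refl _
  refine Finsupp.lhom_ext' fun a => LinearMap.ext_ring ?_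
  simp only [LinearMap.comp_apply, Finsupp.lsingle_apply, Module.End.mul_apply, cechEnd_single]
  by_cases hi : a i = 0 <;> by_cases hj : a j = 0 <;>
    simp only [hi, hj, if_true, if_false, map_sub, map_smul, cechEnd_single, ne_eq, hij,
      hij.symm, not_false_eq_true, Function.update_of_ne]
  rw [Function.update_comm hij]
  simp only [smul_sub, smul_comm (x i) (x j)]
  abel

/-- The bounded free resolution of the Čech complex of `x = x_1, …, x_k`: the tensor product over
`j` of the complexes `R ⊕ R[T_j] → R[T_j]`, in cohomological degrees `0, …, k`. -/
def cechResolution (x : Fin k → R) : CochainComplex (ModuleCat.{u} R) ℕ :=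
  CochainComplex.of (fun p => ModuleCat.of R (KoszulTerm k ((Fin k → ℕ) →₀ R) p))
    (fun p => ModuleCat.ofHom (koszulCoboundary (cechEnd x) p))
    (fun p => by
      rw [← ModuleCat.ofHom_comp, koszulCoboundary_comp _ (cechEnd_commute x)]
      rfl)

/-- The complex `Hom_R(L, M)`, with `Hom_R(L^i, M)` in homological degree `i`. -/
def homComplex (L : CochainComplex (ModuleCat.{u} R) ℕ) (M : Type u) [AddCommGroup M]
    [Module R M] : ChainComplex (ModuleCat.{u} R) ℕ :=
  ChainComplex.of (fun i => ModuleCat.of R (L.X i →ₗ[R] M))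
    (fun i => ModuleCat.ofHom (LinearMap.lcomp R M (L.d i (i + 1)).hom))
    (fun i => by
      rw [← ModuleCat.ofHom_comp]
      ext f y
      have h := congrArg (fun g => g.hom y) (L.d_comp_d i (i + 1) (i + 1 + 1))
      simp only [ModuleCat.hom_comp, LinearMap.comp_apply] at h
      simp [h])

/-- Čech homology `H_i(Hom_R(L_x, M))` of `M` with respect to `x`, where `L_x` is the free
resolution of the Čech complex of `x`. -/
def cechHomology (x : Fin k → R) (M : Type u) [AddCommGroup M] [Module R M] (i : ℕ) :
    ModuleCat.{u} R :=
  (homComplex (cechResolution x) M).homology i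

end Cech

end CechKoszul

end

/-
By tensor-hom adjunction `Hom(L_x, Hom(I, J)) ≅ Hom(I ⊗ L_x, J)`, so the Čech homology vanishes for
injective `J` once `I ⊗ L_x` is exact in positive degrees, and only then if `J` is a cogenerator.
The complex `I ⊗ L_x` is a telescope of the Koszul cochain complexes of the sequences
`x^(n)` with coefficients in `I`: its `n`-th finite stage contracts onto a copy of the `n`-th of
them, and every cochain lives in a finite stage. Hence it is exact in positive degrees if and only
if every Koszul cohomology class for `x^(n)` dies for some `x^(m)`. The Koszul cochain complex with
coefficients in `I` is the `I`-dual of the Koszul chain complex over `R`, so weak proregularity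
gives this for injective `I`. Conversely, choosing `I` to contain the Koszul chains of `x^(n)`
modulo boundaries, the death of a single tautological class yields weak proregularity.
-/

noncomputable section

namespace CechKoszul

open Filter Finsupp TensorProduct

section Homology

variable {R : Type u} [CommRing R]

lemma shortComplex_homologyMap_eq_zero_iff {S T : ShortComplex (ModuleCat.{u} R)} (φ : S ⟶ T) :
    ShortComplex.homologyMap φ = 0 ↔
      LinearMap.ker S.g.hom ≤ (LinearMap.range T.f.hom).comap φ.τ₂.hom := by
  have hfactor : S.homologyπ ≫ ShortComplex.homologyMap φ ≫ T.homologyι =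
      S.iCycles ≫ φ.τ₂ ≫ T.pOpcycles := by
    rw [ShortComplex.homologyπ_naturality_assoc, ShortComplex.homology_π_ι,
      ShortComplex.cyclesMap_i_assoc]
  rw [← cancel_epi S.homologyπ, ← cancel_mono T.homologyι, Category.assoc, hfactor,
    Limits.comp_zero, Limits.zero_comp, ← cancel_epi S.moduleCatCyclesIso.inv,
    ShortComplex.moduleCatCyclesIso_inv_iCycles_assoc, Limits.comp_zero]
  simp only [SetLike.le_def, Submodule.mem_comap]
  refine ⟨fun h z hz => (T.moduleCat_pOpcycles_eq_zero_iff _).mp ?_, fun h => ?_⟩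
  · exact congrArg (fun f => f.hom ⟨z, hz⟩) h
  · ext z
    exact (T.moduleCat_pOpcycles_eq_zero_iff _).mpr (h z.2)

lemma homologyMap_eq_zero_iff {ι : Type*} {c : ComplexShape ι}
    {K L : HomologicalComplex (ModuleCat.{u} R) c} (φ : K ⟶ L) {i j l : ι}
    (hi : c.prev j = i) (hl : c.next j = l) :
    HomologicalComplex.homologyMap φ j = 0 ↔
      LinearMap.ker (K.d j l).hom ≤ (LinearMap.range (L.d i j).hom).comap (φ.f j).hom := by
  subst hi hl
  exact shortComplex_homologyMap_eq_zero_iff _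

lemma isZero_homology_iff {ι : Type*} {c : ComplexShape ι}
    (K : HomologicalComplex (ModuleCat.{u} R) c) {i j l : ι}
    (hi : c.prev j = i) (hl : c.next j = l) :
    Limits.IsZero (K.homology j) ↔ Function.Exact (K.d i j) (K.d j l) := by
  rw [← K.exactAt_iff_isZero_homology, K.exactAt_iff' i j l hi hl]
  exact ShortComplex.ShortExact.moduleCat_exact_iff_function_exact _

variable {k : ℕ} (x : Fin k → R)

lemma isWeaklyProregular_iff : IsWeaklyProregular x ↔ ∀ q n : ℕ, 0 < n → ∃ m ≥ n,
    LinearMap.ker (koszulBoundary (mulEnd (fun j => x j ^ m) R) q) ≤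
      (LinearMap.range (koszulBoundary (mulEnd (fun j => x j ^ n) R) (q + 1))).comap
        (koszulPowHom x R m n (q + 1)) := by
  have hd (n p : ℕ) : (koszulComplex (fun j => x j ^ n) R).d (p + 1) p =
      ModuleCat.ofHom (koszulBoundary (mulEnd (fun j => x j ^ n) R) p) := by
    simp only [koszulComplex, ChainComplex.of_d]
  have hzero (q n m : ℕ) (h : n ≤ m) :
      HomologicalComplex.homologyMap (koszulPowMap x R h) (q + 1) = 0 ↔
        LinearMap.ker (koszulBoundary (mulEnd (fun j => x j ^ m) R) q) ≤
          (LinearMap.range (koszulBoundary (mulEnd (fun j => x j ^ n) R) (q + 1))).comap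
            (koszulPowHom x R m n (q + 1)) := by
    rw [homologyMap_eq_zero_iff _ (i := q + 2) (l := q) (by simp) (by simp), hd, hd]
    rfl
  refine ⟨fun H q n hn => ?_, ?_⟩
  · obtain ⟨m, h, hm⟩ := H (q + 1) q.succ_pos n hn
    exact ⟨m, h, (hzero q n m h).mp hm⟩
  · rintro H (_ | q) hq n hn
    · exact absurd hq (lt_irrefl 0)
    · obtain ⟨m, h, hm⟩ := H q n hn
      exact ⟨m, h, (hzero q n m h).mpr hm⟩

lemma isZero_cechHomology_iff (M : Type u) [AddCommGroup M] [Module R M] (q : ℕ) :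
    Limits.IsZero (cechHomology x M (q + 1)) ↔
      Function.Exact (LinearMap.lcomp R M (koszulCoboundary (cechEnd x) (q + 1)))
        (LinearMap.lcomp R M (koszulCoboundary (cechEnd x) q)) := by
  have hd (p : ℕ) : (homComplex (cechResolution x) M).d (p + 1) p =
      ModuleCat.ofHom (LinearMap.lcomp R M (koszulCoboundary (cechEnd x) p)) := by
    simp only [homComplex, ChainComplex.of_d, cechResolution, CochainComplex.of_d]
  rw [cechHomology, isZero_homology_iff _ (i := q + 2) (l := q) (by simp) (by simp), hd, hd]
  rfl

end Homology

section Koszul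

lemma sgn_mul_self {k : ℕ} (S : Finset (Fin k)) (j : Fin k) : sgn S j * sgn S j = 1 := by
  rw [sgn, ← mul_pow]
  simp

lemma sgn_insert_self {k : ℕ} (S : Finset (Fin k)) (j : Fin k) :
    sgn (insert j S) j = sgn S j := by
  rw [← sgn_erase (insert j S), Finset.erase_insert_eq_erase, sgn_erase]

lemma sgn_mul_sgn_erase_add {k : ℕ} {S : Finset (Fin k)} {i j : Fin k} (hi : i ∈ S) (hj : j ∉ S) :
    sgn S i * sgn (S.erase i) j + sgn S j * sgn (insert j S) i = 0 := by
  have hij : i ≠ j := fun h => hj (h ▸ hi)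
  have key := sgn_mul_sgn_insert (S := S.erase i) (j := i) (l := j) (Finset.notMem_erase i S)
    (fun h => hj (Finset.mem_of_mem_erase h)) hij
  rw [Finset.insert_erase hi, ← Finset.erase_insert_of_ne hij.symm, sgn_erase, sgn_erase] at key
  linear_combination sgn S j * sgn (S.erase i) j * key -
    sgn S i * sgn (S.erase i) j * sgn_mul_self S j -
    sgn S j * sgn (insert j S) i * sgn_mul_self (S.erase i) j

variable {R : Type u} [CommRing R] {k : ℕ} {N : Type u} [AddCommGroup N] [Module R N]

lemma koszulCoboundary_coe (φ : Fin k → Module.End R N) (p : ℕ) (c : Finset (Fin k) → N) :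
    koszulCoboundary φ p (fun S => c S.1) =
      fun S => ∑ j ∈ S.1, sgn S.1 j • φ j (c (S.1.erase j)) :=
  funext fun S => Finset.sum_coe_sort S.1 fun j => sgn S.1 j • φ j (c (S.1.erase j))

lemma koszulBoundary_coe (φ : Fin k → Module.End R N) (p : ℕ) (c : Finset (Fin k) → N) :
    koszulBoundary φ p (fun S => c S.1) =
      fun S => ∑ j ∈ S.1ᶜ, sgn S.1 j • φ j (c (insert j S.1)) :=
  funext fun S => (Finset.sum_subtype S.1ᶜ (fun _ => Finset.mem_compl)
    fun j => sgn S.1 j • φ j (c (insert j S.1))).symm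

lemma koszulCoboundary_koszulBoundary_coe (φ ψ : Fin k → Module.End R N) (p : ℕ)
    (c : Finset (Fin k) → N) :
    koszulCoboundary φ p (koszulBoundary ψ p fun S => c S.1) = fun S =>
      ∑ j ∈ S.1, φ j (ψ j (c S.1)) + ∑ i ∈ S.1, ∑ j ∈ S.1ᶜ,
        (sgn S.1 i * sgn (S.1.erase i) j) • φ i (ψ j (c (insert j (S.1.erase i)))) := by
  rw [koszulBoundary_coe, koszulCoboundary_coe φ p
    fun S => ∑ j ∈ Sᶜ, sgn S j • ψ j (c (insert j S))]
  funext S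
  rw [← Finset.sum_add_distrib]
  refine Finset.sum_congr rfl fun i hi => ?_
  rw [Finset.compl_erase, Finset.sum_insert (by simpa using hi), Finset.insert_erase hi, sgn_erase]
  simp only [map_add, map_sum, map_zsmul, smul_add, Finset.smul_sum, smul_smul, sgn_mul_self,
    one_smul]

lemma koszulBoundary_koszulCoboundary_coe (φ ψ : Fin k → Module.End R N) (p : ℕ)
    (c : Finset (Fin k) → N) :
    koszulBoundary ψ p (koszulCoboundary φ p fun S => c S.1) = fun S =>
      ∑ j ∈ S.1ᶜ, ψ j (φ j (c S.1)) + ∑ j ∈ S.1ᶜ, ∑ i ∈ S.1,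
        (sgn S.1 j * sgn (insert j S.1) i) • ψ j (φ i (c (insert j (S.1.erase i)))) := by
  rw [koszulCoboundary_coe, koszulBoundary_coe ψ p
    fun S => ∑ j ∈ S, sgn S j • φ j (c (S.erase j))]
  funext S
  rw [← Finset.sum_add_distrib]
  refine Finset.sum_congr rfl fun j hj => ?_
  rw [Finset.mem_compl] at hj
  rw [Finset.sum_insert hj, Finset.erase_insert hj, sgn_insert_self]
  simp only [map_add, map_sum, map_zsmul, smul_add, Finset.smul_sum, smul_smul, sgn_mul_self,
    one_smul]
  refine congrArg _ (Finset.sum_congr rfl fun i hi => ?_)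
  have hji : j ≠ i := fun e => hj (e ▸ hi)
  rw [Finset.erase_insert_of_ne hji]

lemma koszulCoboundary_koszulBoundary_add (φ ψ : Fin k → Module.End R N)
    (h : ∀ i j, i ≠ j → Commute (φ i) (ψ j)) (p : ℕ) (c : KoszulTerm k N (p + 1)) :
    koszulCoboundary φ p (koszulBoundary ψ p c) +
        koszulBoundary ψ (p + 1) (koszulCoboundary φ (p + 1) c) =
      fun S => ∑ j ∈ S.1, φ j (ψ j (c S)) + ∑ j ∈ S.1ᶜ, ψ j (φ j (c S)) := by
  obtain ⟨c, rfl⟩ : ∃ c' : Finset (Fin k) → N, (fun S => c' S.1) = c :=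
    LinearMap.funLeft_surjective_of_injective R N _ Subtype.val_injective c
  rw [koszulCoboundary_koszulBoundary_coe, koszulBoundary_koszulCoboundary_coe]
  funext S
  rw [Pi.add_apply, add_add_add_comm, Finset.sum_comm (s := S.1), ← Finset.sum_add_distrib,
    add_eq_left]
  refine Finset.sum_eq_zero fun j hj => ?_
  rw [← Finset.sum_add_distrib]
  refine Finset.sum_eq_zero fun i hi => ?_
  have hj' := Finset.mem_compl.mp hj
  have hcomm := LinearMap.congr_fun (h i j fun e => hj' (e ▸ hi)) (c (insert j (S.1.erase i)))
  simp only [Module.End.mul_apply] at hcomm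
  rw [hcomm, ← add_smul, sgn_mul_sgn_erase_add hi hj', zero_smul]

lemma koszulCoboundary_homotopy (φ : Fin k → Module.End R N) {j : Fin k}
    {h : Module.End R N} (hφ : ∀ i, i ≠ j → Commute (φ i) h) (p : ℕ)
    {c : KoszulTerm k N (p + 1)} (hc : koszulCoboundary φ (p + 1) c = 0) :
    (fun S => (if j ∈ S.1 then φ j * h else h * φ j) (c S)) ∈
      LinearMap.range (koszulCoboundary φ p) := by
  refine ⟨koszulBoundary (Pi.single j h) p c, ?_⟩
  have key := koszulCoboundary_koszulBoundary_add φ (Pi.single j h) (fun i l hil => ?_) p c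
  · have hoff (i : Fin k) (v : N) (hi : i ≠ j) :
        (Pi.single j h : Fin k → Module.End R N) i v = 0 := by
      rw [Pi.single_eq_of_ne hi, LinearMap.zero_apply]
    rw [hc, map_zero, add_zero] at key
    rw [key]
    funext S
    split_ifs with hj
    · rw [Finset.sum_eq_single_of_mem j hj fun i _ hi => by rw [hoff i _ hi, map_zero],
        Finset.sum_eq_zero fun i hi => hoff i _ fun e => Finset.mem_compl.mp hi (e ▸ hj), add_zero,
        Pi.single_eq_same, Module.End.mul_apply]
    · rw [Finset.sum_eq_zero fun i hi => by rw [hoff i _ fun e => hj (e ▸ hi), map_zero],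
        Finset.sum_eq_single_of_mem j (Finset.mem_compl.mpr hj) fun i _ hi => hoff i _ hi,
        zero_add, Pi.single_eq_same, Module.End.mul_apply]
  · rcases eq_or_ne l j with rfl | hl
    · simpa using hφ i hil
    · simp [Pi.single_eq_of_ne hl]

lemma koszulCoboundary_map {N' : Type u} [AddCommGroup N'] [Module R N']
    (φ : Fin k → Module.End R N) (φ' : Fin k → Module.End R N')
    (T : Finset (Fin k) → N →ₗ[R] N') (p : ℕ) (c : KoszulTerm k N p)
    (h : ∀ S, ∀ j ∉ S.1, φ' j (T S.1 (c S)) = T (insert j S.1) (φ j (c S))) :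
    koszulCoboundary φ' p (fun S => T S.1 (c S)) =
      fun S => T S.1 (koszulCoboundary φ p c S) := by
  funext S
  simp only [koszulCoboundary, LinearMap.coe_mk, AddHom.coe_mk, map_sum, map_zsmul]
  refine Finset.sum_congr rfl fun j _ => ?_
  rw [h ⟨S.1.erase j.1, _⟩ j.1 (Finset.notMem_erase _ _), Finset.insert_erase j.2]

end Koszul

section Telescope

variable {R : Type u} [CommRing R] (y : R)

/-- The differential `e_0 ↦ f_0`, `e_{t+1} ↦ f_t - y f_{t+1}` of the free resolution of
`R → R_y`, in the bases `(e_t)` and `(f_t)` used in `cechEnd`. -/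
def telescope : Module.End R (ℕ →₀ R) :=
  linearCombination R fun t =>
    t.casesOn (single 0 1) fun s => single s 1 - y • single (s + 1) 1

/-- The contracting homotopy `f_t ↦ ∑_{s < n - t} y^s e_{t+s+1}` of the telescope of `y` onto its
subcomplex `R → R`, `1 ↦ y^n`, spanned by `telescopeLift y n` and `f_n`. -/
def telescopeHomotopy (n : ℕ) : Module.End R (ℕ →₀ R) :=
  linearCombination R fun t =>
    ∑ s ∈ Finset.range (n - t), y ^ s • single (t + s + 1) 1

/-- The element `e_0 - ∑_{s < n} y^s e_{s+1}` of degree `0`, whose image is `y^n f_n`. -/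
def telescopeLift (n : ℕ) : ℕ →₀ R :=
  single 0 1 - telescopeHomotopy y n (single 0 1)

/-- The functional `f_t ↦ y^(n - t)` on the degree `1` part. Together with the `e_0`-coordinate it
is a chain map to `R → R`, `1 ↦ y^n`, only up to truncation: `n - t` is `0` for `n < t`. -/
def telescopeEval (n : ℕ) : (ℕ →₀ R) →ₗ[R] R :=
  linearCombination R fun t => y ^ (n - t)

@[simp]
lemma telescope_single_zero : telescope y (single 0 1) = single 0 1 := by
  simp [telescope]

@[simp]
lemma telescope_single_succ (t : ℕ) : telescope y (single (t + 1) 1) =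
    single t 1 - y • single (t + 1) 1 := by
  simp [telescope]

@[simp]
lemma telescopeHomotopy_single (n t : ℕ) : telescopeHomotopy y n (single t 1) =
    ∑ s ∈ Finset.range (n - t), y ^ s • single (t + s + 1) 1 := by
  simp [telescopeHomotopy]

@[simp]
lemma telescopeEval_single (n t : ℕ) : telescopeEval y n (single t 1) = y ^ (n - t) := by
  simp [telescopeEval]

lemma telescope_telescopeHomotopy_single {n t : ℕ} (h : t ≤ n) :
    telescope y (telescopeHomotopy y n (single t 1)) =
      single t 1 - y ^ (n - t) • single n 1 := by
  obtain ⟨d, rfl⟩ := Nat.exists_eq_add_of_le h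
  have hterm (s : ℕ) : telescope y (y ^ s • single (t + s + 1) 1) =
      y ^ s • single (t + s) 1 - y ^ (s + 1) • single (t + (s + 1)) 1 := by
    rw [map_smul, telescope_single_succ, smul_sub, smul_smul, ← pow_succ, add_assoc]
  rw [telescopeHomotopy_single, map_sum, Finset.sum_congr rfl fun s _ => hterm s,
    Finset.sum_range_sub', Nat.add_sub_cancel_left]
  simp

lemma telescopeHomotopy_telescope_single_succ {n t : ℕ} (h : t < n) :
    telescopeHomotopy y n (telescope y (single (t + 1) 1)) =
      single (t + 1) 1 := by
  obtain ⟨d, rfl⟩ := Nat.exists_eq_add_of_lt h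
  rw [telescope_single_succ, map_sub, map_smul, telescopeHomotopy_single, telescopeHomotopy_single,
    show t + d + 1 - t = d + 1 by lia, show t + d + 1 - (t + 1) = d by lia,
    Finset.sum_range_succ', Finset.smul_sum, add_sub_right_comm, ← Finset.sum_sub_distrib,
    Finset.sum_eq_zero, zero_add]
  · simp
  · intro s _
    rw [smul_smul, ← pow_succ', sub_eq_zero]
    congr 2
    lia

lemma telescope_telescopeLift (n : ℕ) :
    telescope y (telescopeLift y n) = y ^ n • single n 1 := by
  rw [telescopeLift, map_sub, telescope_telescopeHomotopy_single y n.zero_le,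
    telescope_single_zero, sub_sub_cancel, Nat.sub_zero]

lemma telescopeLift_apply_zero (n : ℕ) : telescopeLift y n 0 = 1 := by
  simp [telescopeLift]

variable {y} {n : ℕ} {a : ℕ →₀ R}

lemma eq_of_mem_supported {M : Type*} [AddCommMonoid M] [Module R M] {s : Set ℕ}
    {f g : (ℕ →₀ R) →ₗ[R] M} (h : ∀ t ∈ s, f (single t 1) = g (single t 1))
    (ha : a ∈ supported R R s) : f a = g a := by
  rw [supported_eq_span_single] at ha
  exact LinearMap.eqOn_span (Set.forall_mem_image.mpr h) ha

lemma telescopeEval_smul_single_add (ha : a ∈ supported R R (Set.Iio n)) :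
    telescopeEval y n a • single n 1 = (1 - telescope y * telescopeHomotopy y n) a := by
  refine eq_of_mem_supported (f := (telescopeEval y n).smulRight (single n 1))
    (fun t ht => ?_) ha
  simp [telescope_telescopeHomotopy_single y (Set.mem_Iio.mp ht).le,
    -telescopeHomotopy_single]

lemma apply_zero_smul_telescopeLift (ha : a ∈ supported R R (Set.Iio n)) :
    a 0 • telescopeLift y n = (1 - telescopeHomotopy y n * telescope y) a := by
  refine eq_of_mem_supported (f := (lapply 0).smulRight (telescopeLift y n))
    (fun t ht => ?_) ha
  rcases t with _ | t
  · simp [telescopeLift]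
  · simp [telescopeHomotopy_telescope_single_succ y (Nat.lt_of_succ_lt ht),
      -telescope_single_succ]

lemma telescopeEval_telescope (ha : a ∈ supported R R (Set.Iio n)) :
    telescopeEval y n (telescope y a) = y ^ n * a 0 := by
  refine eq_of_mem_supported (f := telescopeEval y n ∘ₗ telescope y)
    (g := y ^ n • lapply 0) (fun t ht => ?_) ha
  rcases t with _ | t
  · simp
  · have ht' : n - t = n - (t + 1) + 1 := by have := Set.mem_Iio.mp ht; lia
    simp [ht', pow_succ', -smul_single]

lemma telescopeEval_of_le {m : ℕ} (h : n ≤ m) (ha : a ∈ supported R R (Set.Iio n)) :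
    telescopeEval y m a = y ^ (m - n) * telescopeEval y n a := by
  refine eq_of_mem_supported (g := y ^ (m - n) • telescopeEval y n) (fun t ht => ?_) ha
  have ht' : t < n := ht
  simp [← pow_add, show m - n + (n - t) = m - t by lia]

end Telescope

section TelescopePower

variable {R : Type u} [CommRing R] {k : ℕ}

/-- The `k`-th tensor power of the free module on `ℕ`, tensored with `I`. Every term of the
telescope complex of `k` elements with coefficients in `I` is a direct sum of copies of it. -/
abbrev TelescopePower (R : Type u) [CommRing R] (k : ℕ) (I : Type u) [AddCommGroup I]
    [Module R I] : Type u :=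
  I ⊗[R] (⨂[R] _ : Fin k, ℕ →₀ R)

variable (x : Fin k → R) (I : Type u) [AddCommGroup I] [Module R I]

/-- The action of a family of endomorphisms of the free module on `ℕ`, one for each tensor
factor. -/
def telescopePowerEnd : (Fin k → Module.End R (ℕ →₀ R)) →* Module.End R (TelescopePower R k I) :=
  (MonoidHomClass.toMonoidHom (Module.End.lTensorAlgHom R (⨂[R] _ : Fin k, ℕ →₀ R) I)).comp
     PiTensorProduct.mapMonoidHom

/-- The differential of the `j`-th tensor factor of the telescope complex. -/
def telescopeAt (j : Fin k) : Module.End R (TelescopePower R k I) :=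
  telescopePowerEnd I (Pi.mulSingle j (telescope (x j)))

/-- The component at `e_S` of the inclusion of the Koszul complex of `x^(n)` into the telescope
complex. -/
def koszulInclusion (n : ℕ) (S : Finset (Fin k)) : I →ₗ[R] TelescopePower R k I :=
  (TensorProduct.mk R I _).flip (⨂ₜ[R] j, if j ∈ S then single n 1 else telescopeLift (x j) n)

/-- The component at `e_S` of the projection of the telescope complex to the Koszul complex of
`x^(n)`. -/
def koszulProjection (n : ℕ) (S : Finset (Fin k)) : TelescopePower R k I →ₗ[R] I :=
  TensorProduct.rid R I ∘ₗ (PiTensorProduct.dualDistrib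
    (⨂ₜ[R] j, if j ∈ S then telescopeEval (x j) n else lapply 0)).lTensor I

/-- The component at `e_S` of the identity minus the commutator of the differential and the
contracting homotopy, in each tensor factor. -/
def telescopeRetraction (n : ℕ) (S : Finset (Fin k)) (j : Fin k) : Module.End R (ℕ →₀ R) :=
  1 - if j ∈ S then telescope (x j) * telescopeHomotopy (x j) n
    else telescopeHomotopy (x j) n * telescope (x j)

variable (R k) in
/-- The part of the telescope complex spanned by the basis vectors of index below `n`. -/
def telescopeTruncation (n : ℕ) : Submodule R (TelescopePower R k I) :=
  Submodule.span R {z | ∃ (v : Fin k → ℕ →₀ R) (w : I),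
    (∀ j, v j ∈ supported R R (Set.Iio n)) ∧ w ⊗ₜ (⨂ₜ[R] j, v j) = z}

variable {I}

@[simp]
lemma telescopePowerEnd_tmul (F : Fin k → Module.End R (ℕ →₀ R)) (v : Fin k → ℕ →₀ R) (w : I) :
    telescopePowerEnd I F (w ⊗ₜ (⨂ₜ[R] j, v j)) = w ⊗ₜ (⨂ₜ[R] j, F j (v j)) := by
  change w ⊗ₜ PiTensorProduct.map F (⨂ₜ[R] j, v j) = _
  rw [PiTensorProduct.map_tprod]

@[simp]
lemma telescopeAt_tmul (j : Fin k) (v : Fin k → ℕ →₀ R) (w : I) :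
    telescopeAt x I j (w ⊗ₜ (⨂ₜ[R] i, v i)) =
      w ⊗ₜ (⨂ₜ[R] i, Function.update v j (telescope (x j) (v j)) i) := by
  rw [telescopeAt, telescopePowerEnd_tmul]
  congr 2
  funext i
  rcases eq_or_ne i j with rfl | hi <;> simp [*]

@[simp]
lemma koszulProjection_tmul (n : ℕ) (S : Finset (Fin k)) (v : Fin k → ℕ →₀ R) (w : I) :
    koszulProjection x I n S (w ⊗ₜ (⨂ₜ[R] j, v j)) =
      (∏ j, if j ∈ S then telescopeEval (x j) n (v j) else v j 0) • w := by
  simp only [koszulProjection, LinearMap.comp_apply, LinearMap.lTensor_tmul,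
    LinearEquiv.coe_coe, TensorProduct.rid_tmul, PiTensorProduct.dualDistrib_apply]
  congr 1
  refine Finset.prod_congr rfl fun j _ => ?_
  split_ifs <;> rfl

lemma telescopeAt_koszulInclusion (n : ℕ) {S : Finset (Fin k)} {j : Fin k} (hj : j ∉ S) (w : I) :
    telescopeAt x I j (koszulInclusion x I n S w) =
      koszulInclusion x I n (insert j S) (x j ^ n • w) := by
  simp only [koszulInclusion, LinearMap.flip_apply, TensorProduct.mk_apply, telescopeAt_tmul, hj,
    if_false, telescope_telescopeLift, MultilinearMap.map_update_smul, TensorProduct.smul_tmul]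
  congr 3
  funext i
  rcases eq_or_ne i j with rfl | hi <;> simp [*]

lemma koszulProjection_koszulInclusion (m n : ℕ) (S : Finset (Fin k)) (w : I) :
    koszulProjection x I m S (koszulInclusion x I n S w) = (∏ j ∈ S, x j ^ (m - n)) • w := by
  simp only [koszulInclusion, LinearMap.flip_apply, TensorProduct.mk_apply, koszulProjection_tmul]
  rw [show ∏ j ∈ S, x j ^ (m - n) = ∏ j, if j ∈ S then x j ^ (m - n) else 1 by simp]
  congr 1
  refine Finset.prod_congr rfl fun j _ => ?_
  split_ifs <;> simp [telescopeLift_apply_zero]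

variable {n : ℕ} {z : TelescopePower R k I}

lemma eq_of_mem_telescopeTruncation {M : Type*} [AddCommMonoid M] [Module R M]
    {f g : TelescopePower R k I →ₗ[R] M}
    (h : ∀ (v : Fin k → ℕ →₀ R) (w : I), (∀ j, v j ∈ supported R R (Set.Iio n)) →
      f (w ⊗ₜ (⨂ₜ[R] j, v j)) = g (w ⊗ₜ (⨂ₜ[R] j, v j)))
    (hz : z ∈ telescopeTruncation R k I n) : f z = g z := by
  refine LinearMap.eqOn_span ?_ hz
  rintro _ ⟨v, w, hv, rfl⟩
  exact h v w hv

lemma telescopeTruncation_mono : Monotone (telescopeTruncation R k I) := fun _ _ h =>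
  Submodule.span_mono fun _ ⟨v, w, hv, hz⟩ =>
    ⟨v, w, fun j => supported_mono (Set.Iio_subset_Iio h) (hv j), hz⟩

lemma eventually_mem_telescopeTruncation (z : TelescopePower R k I) :
    ∀ᶠ n in atTop, z ∈ telescopeTruncation R k I n := by
  have hadd {a b : TelescopePower R k I}
      (ha : ∀ᶠ n in atTop, a ∈ telescopeTruncation R k I n)
      (hb : ∀ᶠ n in atTop, b ∈ telescopeTruncation R k I n) :
      ∀ᶠ n in atTop, a + b ∈ telescopeTruncation R k I n :=
    (ha.and hb).mono fun n h => add_mem h.1 h.2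
  have hvec (a : ℕ →₀ R) : ∀ᶠ n in atTop, a ∈ supported R R (Set.Iio n) := by
    filter_upwards [eventually_gt_atTop (a.support.sup id)] with n hn t ht
    exact (Finset.le_sup (f := id) ht).trans_lt hn
  induction z using TensorProduct.induction_on with
  | zero => exact .of_forall fun n => zero_mem _
  | add a b ha hb => exact hadd ha hb
  | tmul w p =>
    induction p using PiTensorProduct.induction_on with
    | smul_tprod r v =>
      filter_upwards [eventually_all.mpr fun j => hvec (v j)] with n hn
      rw [TensorProduct.tmul_smul]
      exact Submodule.smul_mem _ r (Submodule.subset_span ⟨v, w, hn, rfl⟩)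
    | add a b ha hb =>
      rw [TensorProduct.tmul_add]
      exact hadd ha hb

lemma koszulProjection_telescopeAt (hz : z ∈ telescopeTruncation R k I n) {S : Finset (Fin k)}
    {j : Fin k} (hj : j ∉ S) :
    koszulProjection x I n (insert j S) (telescopeAt x I j z) =
      x j ^ n • koszulProjection x I n S z := by
  refine eq_of_mem_telescopeTruncation (f := koszulProjection x I n (insert j S) ∘ₗ
    telescopeAt x I j) (g := x j ^ n • koszulProjection x I n S) (fun v w hv => ?_) hz
  simp only [LinearMap.comp_apply, telescopeAt_tmul, koszulProjection_tmul, LinearMap.smul_apply,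
    smul_smul]
  rw [Fintype.prod_eq_mul_prod_compl j, Fintype.prod_eq_mul_prod_compl j fun i => ite (i ∈ S) _ _,
    ← mul_assoc]
  congr 2
  · simp [hj, telescopeEval_telescope (hv j)]
  · refine Finset.prod_congr rfl fun i hi => ?_
    have hij : i ≠ j := by simpa using hi
    simp [hij]

lemma koszulProjection_of_le {m : ℕ} (h : n ≤ m) (hz : z ∈ telescopeTruncation R k I n)
    (S : Finset (Fin k)) :
    koszulProjection x I m S z = (∏ j ∈ S, x j ^ (m - n)) • koszulProjection x I n S z := by
  refine eq_of_mem_telescopeTruncation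
    (g := (∏ j ∈ S, x j ^ (m - n)) • koszulProjection x I n S) (fun v w hv => ?_) hz
  rw [LinearMap.smul_apply, koszulProjection_tmul, koszulProjection_tmul, smul_smul,
    show ∏ j ∈ S, x j ^ (m - n) = ∏ j, if j ∈ S then x j ^ (m - n) else 1 by simp,
    ← Finset.prod_mul_distrib]
  congr 1
  refine Finset.prod_congr rfl fun j _ => ?_
  split_ifs
  · exact telescopeEval_of_le h (hv j)
  · rw [one_mul]

lemma koszulInclusion_koszulProjection (hz : z ∈ telescopeTruncation R k I n)
    (S : Finset (Fin k)) :
    koszulInclusion x I n S (koszulProjection x I n S z) =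
      telescopePowerEnd I (telescopeRetraction x n S) z := by
  refine eq_of_mem_telescopeTruncation (f := koszulInclusion x I n S ∘ₗ koszulProjection x I n S)
    (fun v w hv => ?_) hz
  simp only [LinearMap.comp_apply, koszulProjection_tmul, telescopePowerEnd_tmul,
    koszulInclusion, LinearMap.flip_apply, TensorProduct.mk_apply]
  rw [TensorProduct.smul_tmul, ← MultilinearMap.map_smul_univ]
  congr 2
  funext j
  rw [telescopeRetraction]
  split_ifs
  · exact telescopeEval_smul_single_add (hv j)
  · exact apply_zero_smul_telescopeLift (hv j)

end TelescopePower

section Comparison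

variable {R : Type u} [CommRing R] {k : ℕ} (x : Fin k → R) {I : Type u} [AddCommGroup I]
  [Module R I]

lemma telescopePowerEnd_commute {i j : Fin k} (hij : i ≠ j) (a b : Module.End R (ℕ →₀ R)) :
    Commute (telescopePowerEnd I (Pi.mulSingle i a)) (telescopePowerEnd I (Pi.mulSingle j b)) :=
  (Pi.mulSingle_commute (f := fun _ => Module.End R (ℕ →₀ R)) hij a b).map (telescopePowerEnd I)

lemma telescopeAt_commute (i j : Fin k) : Commute (telescopeAt x I i) (telescopeAt x I j) := by
  rcases eq_or_ne i j with rfl | hij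
  · exact Commute.refl _
  · exact telescopePowerEnd_commute hij _ _

lemma telescopePowerEnd_mulSingle_one_sub (j : Fin k) (a : Module.End R (ℕ →₀ R)) :
    telescopePowerEnd I (Pi.mulSingle j (1 - a)) = 1 - telescopePowerEnd I (Pi.mulSingle j a) := by
  have h (F : Fin k → Module.End R (ℕ →₀ R)) :
      telescopePowerEnd I F = (PiTensorProduct.map F).lTensor I := rfl
  have h_add (b c : Module.End R (ℕ →₀ R)) :
      telescopePowerEnd I (Pi.mulSingle j (b + c)) =
        telescopePowerEnd I (Pi.mulSingle j b) + telescopePowerEnd I (Pi.mulSingle j c) := by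
    rw [h, h, h, ← LinearMap.lTensor_add, Pi.mulSingle, Pi.mulSingle, Pi.mulSingle,
      ← PiTensorProduct.map_update_add]
  rw [eq_sub_iff_add_eq, ← h_add, show 1 - a + a = 1 from sub_add_cancel 1 a,
    Pi.mulSingle_one, map_one]

variable {x} {p : ℕ} {c : KoszulTerm k (TelescopePower R k I) (p + 1)}

lemma sub_telescopeRetraction_mem_range
    (hc : koszulCoboundary (telescopeAt x I) (p + 1) c = 0) (n : ℕ) (j : Fin k) :
    (c - fun S => telescopePowerEnd I (Pi.mulSingle j (telescopeRetraction x n S.1 j)) (c S)) ∈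
      LinearMap.range (koszulCoboundary (telescopeAt x I) p) := by
  convert koszulCoboundary_homotopy (telescopeAt x I)
    (h := telescopePowerEnd I (Pi.mulSingle j (telescopeHomotopy (x j) n)))
    (fun i hij => telescopePowerEnd_commute hij _ _) p hc using 1
  funext S
  rw [Pi.sub_apply, telescopeRetraction, telescopePowerEnd_mulSingle_one_sub, LinearMap.sub_apply,
    Module.End.one_apply, sub_sub_cancel]
  split_ifs <;> rw [Pi.mulSingle_mul, map_mul] <;> rfl

lemma sub_telescopePowerEnd_mem_range
    (hc : koszulCoboundary (telescopeAt x I) (p + 1) c = 0) (n : ℕ) :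
    (c - fun S => telescopePowerEnd I (telescopeRetraction x n S.1) (c S)) ∈
      LinearMap.range (koszulCoboundary (telescopeAt x I) p) := by
  suffices H : ∀ F : Finset (Fin k),
      (c - fun S => telescopePowerEnd I (F.piecewise (telescopeRetraction x n S.1) 1) (c S)) ∈
        LinearMap.range (koszulCoboundary (telescopeAt x I) p) by
    simpa only [Finset.piecewise_univ] using H Finset.univ
  intro F
  induction F using Finset.induction_on with
  | empty =>
    simp only [Finset.piecewise_empty, map_one, Module.End.one_apply, sub_self, zero_mem]
  | insert j F hj ih =>
    set c' : KoszulTerm k (TelescopePower R k I) (p + 1) := fun S =>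
      telescopePowerEnd I (F.piecewise (telescopeRetraction x n S.1) 1) (c S)
    have hc' : koszulCoboundary (telescopeAt x I) (p + 1) c' = 0 := by
      obtain ⟨b, hb⟩ := ih
      have := LinearMap.congr_fun (koszulCoboundary_comp _ (telescopeAt_commute x (I := I)) p) b
      rw [LinearMap.comp_apply, hb, map_sub, hc, zero_sub, LinearMap.zero_apply,
        neg_eq_zero] at this
      exact this
    convert add_mem ih (sub_telescopeRetraction_mem_range hc' n j) using 1
    rw [sub_add_sub_cancel]
    congr 1
    funext S
    have h : (insert j F).piecewise (telescopeRetraction x n S.1) 1 =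
        Pi.mulSingle j (telescopeRetraction x n S.1 j) *
          F.piecewise (telescopeRetraction x n S.1) 1 := by
      funext i
      rcases eq_or_ne i j with rfl | hij <;> simp [*]
    rw [h, map_mul, Module.End.mul_apply]

lemma koszulCoboundary_koszulInclusion (n p : ℕ) (w : KoszulTerm k I p) :
    koszulCoboundary (telescopeAt x I) p (fun S => koszulInclusion x I n S.1 (w S)) =
      fun S => koszulInclusion x I n S.1 (koszulCoboundary (mulEnd (fun j => x j ^ n) I) p w S) :=
  koszulCoboundary_map _ _ (koszulInclusion x I n) p w fun _ _ hj =>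
    telescopeAt_koszulInclusion x n hj _

lemma koszulCoboundary_koszulProjection {n p : ℕ} {c : KoszulTerm k (TelescopePower R k I) p}
    (hc : ∀ S, c S ∈ telescopeTruncation R k I n) :
    koszulCoboundary (mulEnd (fun j => x j ^ n) I) p (fun S => koszulProjection x I n S.1 (c S)) =
      fun S => koszulProjection x I n S.1 (koszulCoboundary (telescopeAt x I) p c S) :=
  koszulCoboundary_map _ _ (koszulProjection x I n) p c fun S _ hj =>
    (koszulProjection_telescopeAt x (hc S) hj).symm

lemma exists_telescopeTruncation (n : ℕ) {p : ℕ} (c : KoszulTerm k (TelescopePower R k I) p) :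
    ∃ m > n, ∀ S, c S ∈ telescopeTruncation R k I m :=
  ((eventually_gt_atTop n).and
    (eventually_all.mpr fun S => eventually_mem_telescopeTruncation (c S))).exists

/-- Exactness in all positive degrees of the telescope complex of `x` with coefficients in `I`. -/
def TelescopeAcyclic (x : Fin k → R) (I : Type u) [AddCommGroup I] [Module R I] : Prop :=
  ∀ q, Function.Exact (koszulCoboundary (telescopeAt x I) q)
    (koszulCoboundary (telescopeAt x I) (q + 1))

/-- Every class in positive degree of the Koszul cohomology of `x^(n)` with coefficients in `I`
dies in the Koszul cohomology of `x^(m)` for some `m ≥ n`. -/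
def KoszulIndZero (x : Fin k → R) (I : Type u) [AddCommGroup I] [Module R I] : Prop :=
  ∀ q n : ℕ, 0 < n →
    ∀ w ∈ LinearMap.ker (koszulCoboundary (mulEnd (fun j => x j ^ n) I) (q + 1)), ∃ m ≥ n,
      koszulPowHom x I m n (q + 1) w ∈
        LinearMap.range (koszulCoboundary (mulEnd (fun j => x j ^ m) I) q)

lemma KoszulIndZero.telescopeAcyclic (h : KoszulIndZero x I) : TelescopeAcyclic x I := by
  refine fun q c => ⟨fun hc => ?_, ?_⟩
  · obtain ⟨n, hn, hcn⟩ := exists_telescopeTruncation 0 c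
    set w : KoszulTerm k I (q + 1) := fun S => koszulProjection x I n S.1 (c S)
    have hw : koszulCoboundary (mulEnd (fun j => x j ^ n) I) (q + 1) w = 0 := by
      rw [koszulCoboundary_koszulProjection hcn, hc]
      exact funext fun S => map_zero _
    obtain ⟨m, hmn, v, hv⟩ := h q n hn w hw
    have hcm (S) : koszulInclusion x I m S.1 (koszulPowHom x I m n (q + 1) w S) =
        telescopePowerEnd I (telescopeRetraction x m S.1) (c S) := by
      rw [← koszulInclusion_koszulProjection x (telescopeTruncation_mono hmn (hcn S)),
        koszulProjection_of_le x hmn (hcn S)]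
      rfl
    rw [← hv] at hcm
    rw [← LinearMap.coe_range, SetLike.mem_coe]
    convert add_mem (sub_telescopePowerEnd_mem_range hc m) (LinearMap.mem_range_self
      (koszulCoboundary (telescopeAt x I) q) fun S => koszulInclusion x I m S.1 (v S)) using 1
    rw [koszulCoboundary_koszulInclusion, funext hcm, sub_add_cancel]
  · rintro ⟨b, rfl⟩
    exact LinearMap.congr_fun (koszulCoboundary_comp _ (telescopeAt_commute x) q) b

lemma TelescopeAcyclic.koszulIndZero (h : TelescopeAcyclic x I) : KoszulIndZero x I := by
  intro q n _ w hw
  have hcocycle : koszulCoboundary (telescopeAt x I) (q + 1)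
      (fun S => koszulInclusion x I n S.1 (w S)) = 0 := by
    rw [koszulCoboundary_koszulInclusion, LinearMap.mem_ker.mp hw]
    exact funext fun S => map_zero _
  obtain ⟨b, hb⟩ := (h q _).mp hcocycle
  obtain ⟨m, hmn, hbm⟩ := exists_telescopeTruncation n b
  refine ⟨m, hmn.le, fun S => koszulProjection x I m S.1 (b S), ?_⟩
  rw [koszulCoboundary_koszulProjection hbm, hb]
  exact funext fun S => koszulProjection_koszulInclusion x m n S.1 (w S)

theorem koszulIndZero_iff_telescopeAcyclic : KoszulIndZero x I ↔ TelescopeAcyclic x I :=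
  ⟨KoszulIndZero.telescopeAcyclic, TelescopeAcyclic.koszulIndZero⟩

end Comparison

section CechTensor

variable {R : Type u} [CommRing R] {k : ℕ} (x : Fin k → R) (I : Type u) [AddCommGroup I]
  [Module R I]

open Classical in
variable (R k) in
/-- The identification of the terms of `I ⊗ L_x` with those of the telescope complex. -/
def cechTensorEquiv (p : ℕ) :
    I ⊗[R] KoszulTerm k ((Fin k → ℕ) →₀ R) p ≃ₗ[R] KoszulTerm k (TelescopePower R k I) p :=
  piRight R R I (fun _ => (Fin k → ℕ) →₀ R) ≪≫ₗ
    LinearEquiv.piCongrRight fun _ => PiTensorProduct.ofFinsuppEquiv'.symm.lTensor I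

open Classical in
lemma telescopeAt_tmul_ofFinsuppEquiv'_symm (j : Fin k) (w : I) (a : (Fin k → ℕ) →₀ R) :
    telescopeAt x I j (w ⊗ₜ PiTensorProduct.ofFinsuppEquiv'.symm a) =
      w ⊗ₜ PiTensorProduct.ofFinsuppEquiv'.symm (cechEnd x j a) := by
  have hsingle (b : Fin k → ℕ) :
      PiTensorProduct.ofFinsuppEquiv'.symm (single b (1 : R)) = ⨂ₜ[R] i, single (b i) 1 := by
    rw [LinearEquiv.symm_apply_eq, PiTensorProduct.ofFinsuppEquiv'_tprod_single,
      Finset.prod_const_one]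
  have hupdate (b : Fin k → ℕ) (s : ℕ) :
      PiTensorProduct.tprod R (Function.update (fun i => single (b i) (1 : R)) j (single s 1)) =
        PiTensorProduct.ofFinsuppEquiv'.symm (single (Function.update b j s) (1 : R)) := by
    rw [hsingle]
    congr 1
    funext i
    rcases eq_or_ne i j with rfl | hij <;> simp [*]
  suffices h : telescopeAt x I j ∘ₗ TensorProduct.mk R I _ w ∘ₗ
      (PiTensorProduct.ofFinsuppEquiv' (R := R)).symm.toLinearMap =
      TensorProduct.mk R I _ w ∘ₗ PiTensorProduct.ofFinsuppEquiv'.symm.toLinearMap ∘ₗ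
        cechEnd x j from LinearMap.congr_fun h a
  refine Finsupp.lhom_ext' fun b => LinearMap.ext_ring ?_
  simp only [LinearMap.comp_apply, lsingle_apply, LinearEquiv.coe_coe, mk_apply, hsingle,
    cechEnd_single, telescopeAt_tmul]
  change w ⊗ₜ PiTensorProduct.tprod R (Function.update (fun i => single (b i) (1 : R)) j _) = _
  split_ifs with hb
  · rw [hb, telescope_single_zero, hupdate, ← hb, Function.update_eq_self]
  · obtain ⟨s, hs⟩ := Nat.exists_eq_succ_of_ne_zero hb
    rw [hs, telescope_single_succ, ← Nat.succ_eq_add_one, ← hs,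
      MultilinearMap.map_update_sub (PiTensorProduct.tprod R) (fun i => single (b i) (1 : R)) j,
      MultilinearMap.map_update_smul, hupdate, hupdate, Function.update_eq_self, map_sub, map_smul,
      hs, Nat.succ_sub_one]

lemma koszulCoboundary_cechTensorEquiv (p : ℕ) :
    koszulCoboundary (telescopeAt x I) p ∘ₗ (cechTensorEquiv R k I p).toLinearMap =
      (cechTensorEquiv R k I (p + 1)).toLinearMap ∘ₗ
        (koszulCoboundary (cechEnd x) p).lTensor I := by
  classical
  refine TensorProduct.ext' fun w c => ?_
  exact koszulCoboundary_map (cechEnd x) (telescopeAt x I)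
    (fun _ => TensorProduct.mk R I _ w ∘ₗ PiTensorProduct.ofFinsuppEquiv'.symm.toLinearMap) p c
    fun S j _ => telescopeAt_tmul_ofFinsuppEquiv'_symm x I j w (c S)

theorem telescopeAcyclic_iff_exact : TelescopeAcyclic x I ↔ ∀ q,
    Function.Exact ((koszulCoboundary (cechEnd x) q).lTensor I)
      ((koszulCoboundary (cechEnd x) (q + 1)).lTensor I) :=
  forall_congr' fun q => Function.Exact.iff_of_ladder_linearEquiv
    (koszulCoboundary_cechTensorEquiv x I q) (koszulCoboundary_cechTensorEquiv x I (q + 1))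

end CechTensor

section Duality

variable {R : Type u} [CommRing R] {L M N I J : Type u} [AddCommGroup L] [Module R L]
  [AddCommGroup M] [Module R M] [AddCommGroup N] [Module R N] [AddCommGroup I] [Module R I]
  [AddCommGroup J] [Module R J]

lemma exists_comp_eq_of_ker_le {g : M →ₗ[R] N} {φ : M →ₗ[R] J} (hJ : Module.Injective R J)
    (h : LinearMap.ker g ≤ LinearMap.ker φ) : ∃ ψ : N →ₗ[R] J, ψ ∘ₗ g = φ := by
  obtain ⟨ψ, hψ⟩ := hJ.out ((LinearMap.ker g).liftQ g le_rfl)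
    (LinearMap.ker_eq_bot.mp (Submodule.ker_liftQ_eq_bot _ _ _ le_rfl))
    ((LinearMap.ker g).liftQ φ h)
  exact ⟨ψ, LinearMap.ext fun z => hψ (Submodule.Quotient.mk z)⟩

lemma exact_lcomp_of_injective {f : L →ₗ[R] M} {g : M →ₗ[R] N} (hJ : Module.Injective R J)
    (h : Function.Exact f g) :
    Function.Exact (LinearMap.lcomp R J g) (LinearMap.lcomp R J f) := by
  refine fun φ => ⟨fun hφ => exists_comp_eq_of_ker_le hJ ?_, ?_⟩
  · rw [h.linearMap_ker_eq]
    exact LinearMap.range_le_ker_iff.mpr hφ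
  · rintro ⟨ψ, rfl⟩
    exact LinearMap.ext fun z => (congrArg ψ (h.apply_apply_eq_zero z)).trans (map_zero ψ)

lemma exists_linearMap_apply_ne_zero (hJ : IsCoseparator (ModuleCat.of R J)) {z : M} (hz : z ≠ 0) :
    ∃ φ : M →ₗ[R] J, φ z ≠ 0 := by
  by_contra! H
  have h : ModuleCat.ofHom (LinearMap.toSpanSingleton R M z) = 0 :=
    (Preadditive.isCoseparator_iff _).mp hJ _ fun φ => by
      ext
      simpa using H φ.hom
  exact hz (by simpa using congrArg (fun f => f.hom (1 : R)) h)

lemma exact_of_exact_lcomp {f : L →ₗ[R] M} {g : M →ₗ[R] N}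
    (hJ : IsCoseparator (ModuleCat.of R J))
    (h : Function.Exact (LinearMap.lcomp R J g) (LinearMap.lcomp R J f)) :
    Function.Exact f g := by
  refine fun z => ⟨fun hz => ?_, ?_⟩
  · by_contra hrange
    obtain ⟨φ, hφ⟩ := exists_linearMap_apply_ne_zero hJ (z := (LinearMap.range f).mkQ z)
      fun h0 => hrange ((Submodule.Quotient.mk_eq_zero _).mp h0)
    obtain ⟨ψ, hψ⟩ := (h (φ ∘ₗ (LinearMap.range f).mkQ)).mp
      (by rw [LinearMap.lcomp_apply', LinearMap.comp_assoc, LinearMap.range_mkQ_comp,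
        LinearMap.comp_zero])
    apply hφ
    rw [← LinearMap.comp_apply, ← hψ, LinearMap.lcomp_apply, hz, map_zero]
  · rintro ⟨y, rfl⟩
    by_contra hne
    obtain ⟨φ, hφ⟩ := exists_linearMap_apply_ne_zero hJ hne
    exact hφ (LinearMap.congr_fun (h.apply_apply_eq_zero φ) y)

lemma exact_lcomp_linearMap_iff {f : L →ₗ[R] M} {g : M →ₗ[R] N} :
    Function.Exact (LinearMap.lcomp R (I →ₗ[R] J) g) (LinearMap.lcomp R (I →ₗ[R] J) f) ↔
      Function.Exact (LinearMap.lcomp R J (g.lTensor I)) (LinearMap.lcomp R J (f.lTensor I)) := by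
  let e (P : Type u) [AddCommGroup P] [Module R P] :=
    LinearMap.lflip (R₀ := R) ≪≫ₗ TensorProduct.lift.equiv (.id R) I P J
  refine (Function.Exact.iff_of_ladder_linearEquiv (e₁ := e N) (e₂ := e M) (e₃ := e L) ?_ ?_).symm
  all_goals exact LinearMap.ext fun φ => TensorProduct.ext' fun w y => rfl

lemma exists_injective_embedding (M : Type u) [AddCommGroup M] [Module R M] :
    ∃ (I : Type u) (_ : AddCommGroup I) (_ : Module R I) (ι : M →ₗ[R] I),
      Module.Injective R I ∧ Function.Injective ι :=
  ⟨(Injective.under (ModuleCat.of R M) : ModuleCat.{u} R), inferInstance, inferInstance,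
    (Injective.ι (ModuleCat.of R M)).hom,
    (Module.injective_iff_injective_object R _).mpr
      (inferInstanceAs (Injective (Injective.under (ModuleCat.of R M)))),
    (ModuleCat.mono_iff_injective _).mp inferInstance⟩

end Duality

section Pairing

variable {R : Type u} [CommRing R] {k : ℕ} {I : Type u} [AddCommGroup I] [Module R I]

lemma piEquiv_coe {p : ℕ} (w : Finset (Fin k) → I) (f : Finset (Fin k) → R) :
    Module.piEquiv {S : Finset (Fin k) // S.card = p} R I (fun S => w S.1) (fun S => f S.1) =
      ∑ S with S.card = p, f S • w S := by
  rw [Module.piEquiv_apply_apply]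
  exact (Finset.sum_subtype _ (by simp) fun S => f S • w S).symm

lemma sum_compl_insert_eq_sum {A : Type*} [AddCommMonoid A] (p : ℕ)
    (F : Finset (Fin k) → Fin k → A) :
    ∑ S with S.card = p, ∑ j ∈ Sᶜ, F (insert j S) j = ∑ S with S.card = p + 1, ∑ j ∈ S, F S j := by
  rw [Finset.sum_sigma', Finset.sum_sigma']
  refine Finset.sum_bij' (fun a _ => ⟨insert a.2 a.1, a.2⟩) (fun a _ => ⟨a.1.erase a.2, a.2⟩)
    ?_ ?_ ?_ ?_ fun _ _ => rfl
  all_goals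
    rintro ⟨S, j⟩ h
    simp only [Finset.mem_sigma, Finset.mem_filter_univ, Finset.mem_compl] at h
  · simp [Finset.card_insert_of_notMem h.2, h.1]
  · simp [Finset.card_erase_of_mem h.2, h.1]
  · simp [Finset.erase_insert h.2]
  · simp [Finset.insert_erase h.2]

lemma piEquiv_koszulCoboundary (y : Fin k → R) {p : ℕ} (w : KoszulTerm k I p) :
    Module.piEquiv _ R I (koszulCoboundary (mulEnd y I) p w) =
      Module.piEquiv _ R I w ∘ₗ koszulBoundary (mulEnd y R) p := by
  refine LinearMap.ext fun f => ?_
  obtain ⟨w, rfl⟩ : ∃ w' : Finset (Fin k) → I, (fun S => w' S.1) = w :=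
    LinearMap.funLeft_surjective_of_injective R I _ Subtype.val_injective w
  obtain ⟨f, rfl⟩ : ∃ f' : Finset (Fin k) → R, (fun S => f' S.1) = f :=
    LinearMap.funLeft_surjective_of_injective R R _ Subtype.val_injective f
  rw [LinearMap.comp_apply, koszulCoboundary_coe, koszulBoundary_coe,
    piEquiv_coe (fun S => ∑ j ∈ S, sgn S j • mulEnd y I j (w (S.erase j))),
    piEquiv_coe _ fun S => ∑ j ∈ Sᶜ, sgn S j • mulEnd y R j (f (insert j S))]
  simp only [Finset.smul_sum, Finset.sum_smul]
  rw [← sum_compl_insert_eq_sum p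
    fun S j => f S • sgn S j • mulEnd y I j (w (S.erase j))]
  refine Finset.sum_congr rfl fun S _ => Finset.sum_congr rfl fun j hj => ?_
  rw [Finset.erase_insert (Finset.mem_compl.mp hj), sgn_insert_self]
  simp only [mulEnd, LinearMap.lsmul_apply, smul_eq_mul, ← Int.cast_smul_eq_zsmul R, smul_smul]
  congr 1
  ring

lemma piEquiv_koszulPowHom (x : Fin k → R) (m n : ℕ) {p : ℕ} (w : KoszulTerm k I p) :
    Module.piEquiv _ R I (koszulPowHom x I m n p w) =
      Module.piEquiv _ R I w ∘ₗ koszulPowHom x R m n p := by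
  refine LinearMap.ext fun f => ?_
  rw [LinearMap.comp_apply, Module.piEquiv_apply_apply, Module.piEquiv_apply_apply]
  refine Finset.sum_congr rfl fun S _ => ?_
  simp only [koszulPowHom, LinearMap.pi_apply, LinearMap.smul_apply, LinearMap.proj_apply,
    smul_smul, smul_eq_mul, mul_comm]

lemma IsWeaklyProregular.koszulIndZero {x : Fin k → R} (hx : IsWeaklyProregular x)
    (hI : Module.Injective R I) : KoszulIndZero x I := by
  intro q n hn w hw
  obtain ⟨m, hnm, hm⟩ := (isWeaklyProregular_iff x).mp hx q n hn
  refine ⟨m, hnm, ?_⟩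
  have hcycle : Module.piEquiv _ R I w ∘ₗ koszulBoundary (mulEnd (fun j => x j ^ n) R) (q + 1) =
      0 := by
    rw [← piEquiv_koszulCoboundary, hw, map_zero]
  obtain ⟨ψ, hψ⟩ := exists_comp_eq_of_ker_le hI
    (g := koszulBoundary (mulEnd (fun j => x j ^ m) R) q)
    (φ := Module.piEquiv _ R I w ∘ₗ koszulPowHom x R m n (q + 1)) <| by
      rw [LinearMap.ker_comp]
      exact hm.trans (Submodule.comap_mono (LinearMap.range_le_ker_iff.mpr hcycle))
  refine ⟨(Module.piEquiv _ R I).symm ψ, (Module.piEquiv _ R I).injective ?_⟩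
  rw [piEquiv_koszulCoboundary, LinearEquiv.apply_symm_apply, hψ, piEquiv_koszulPowHom]

lemma isWeaklyProregular_of_koszulIndZero {x : Fin k → R}
    (H : ∀ (I : Type u) [AddCommGroup I] [Module R I], Module.Injective R I → KoszulIndZero x I) :
    IsWeaklyProregular x := by
  refine (isWeaklyProregular_iff x).mpr fun q n hn => ?_
  let B := LinearMap.range (koszulBoundary (mulEnd (fun j => x j ^ n) R) (q + 1))
  obtain ⟨I, _, _, ι, hI, hι⟩ := exists_injective_embedding (R := R) (KoszulTerm k R (q + 1) ⧸ B)
  have hker : LinearMap.ker (ι ∘ₗ B.mkQ) = B := by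
    rw [LinearMap.ker_comp_of_ker_eq_bot _ (LinearMap.ker_eq_bot.mpr hι), Submodule.ker_mkQ]
  obtain ⟨w, hw⟩ := (Module.piEquiv _ R I).surjective (ι ∘ₗ B.mkQ)
  obtain ⟨m, hnm, v, hv⟩ := H I hI q n hn w <| (Module.piEquiv _ R I).injective <| by
    rw [piEquiv_koszulCoboundary, map_zero, hw]
    exact LinearMap.range_le_ker_iff.mp hker.ge
  refine ⟨m, hnm, fun z hz => ?_⟩
  change koszulPowHom x R m n (q + 1) z ∈ B
  rw [← hker, LinearMap.mem_ker, ← hw, ← LinearMap.comp_apply, ← piEquiv_koszulPowHom, ← hv,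
    piEquiv_koszulCoboundary, LinearMap.comp_apply, LinearMap.mem_ker.mp hz, map_zero]

end Pairing

section CechHomology

variable {R : Type u} [CommRing R] {k : ℕ} {x : Fin k → R} {I J : Type u} [AddCommGroup I]
  [Module R I] [AddCommGroup J] [Module R J]

lemma koszulIndZero_iff_exact : KoszulIndZero x I ↔ ∀ q,
    Function.Exact ((koszulCoboundary (cechEnd x) q).lTensor I)
      ((koszulCoboundary (cechEnd x) (q + 1)).lTensor I) :=
  koszulIndZero_iff_telescopeAcyclic.trans (telescopeAcyclic_iff_exact x I)

lemma KoszulIndZero.isZero_cechHomology (h : KoszulIndZero x I) (hJ : Module.Injective R J)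
    (q : ℕ) : Limits.IsZero (cechHomology x (I →ₗ[R] J) (q + 1)) :=
  (isZero_cechHomology_iff x _ q).mpr <| exact_lcomp_linearMap_iff.mpr <|
    exact_lcomp_of_injective hJ (koszulIndZero_iff_exact.mp h q)

lemma koszulIndZero_of_isZero_cechHomology (hJ : IsCoseparator (ModuleCat.of R J))
    (h : ∀ q, Limits.IsZero (cechHomology x (I →ₗ[R] J) (q + 1))) : KoszulIndZero x I :=
  koszulIndZero_iff_exact.mpr fun q => exact_of_exact_lcomp hJ <|
    exact_lcomp_linearMap_iff.mp <| (isZero_cechHomology_iff x _ q).mp (h q)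

end CechHomology

end CechKoszul

end

theorem proposition3p7 {R : Type u} [CommRing R] {k : ℕ} (x : Fin k → R)
    (E : Type u) [AddCommGroup E] [Module R E]
    (hE : Module.Injective R E)
    (hE' : CategoryTheory.IsCoseparator (ModuleCat.of R E)) :
    List.TFAE [
      CechKoszul.IsWeaklyProregular x,
      ∀ (I J : Type u) [AddCommGroup I] [Module R I] [AddCommGroup J] [Module R J],
        Module.Injective R I → Module.Injective R J →
        ∀ i : ℕ, 0 < i →
          CategoryTheory.Limits.IsZero (CechKoszul.cechHomology x (I →ₗ[R] J) i),
      ∀ (I : Type u) [AddCommGroup I] [Module R I],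
        Module.Injective R I →
        ∀ i : ℕ, 0 < i →
          CategoryTheory.Limits.IsZero (CechKoszul.cechHomology x (I →ₗ[R] E) i)] := by
  tfae_have 1 → 2 := by
    rintro hx I J _ _ _ _ hI hJ (_ | q) hi
    · exact absurd hi (lt_irrefl 0)
    · exact (hx.koszulIndZero hI).isZero_cechHomology hJ q
  tfae_have 2 → 3 := fun H I _ _ hI => H I E hI hE
  tfae_have 3 → 1 := fun H => CechKoszul.isWeaklyProregular_of_koszulIndZero fun I _ _ hI =>
    CechKoszul.koszulIndZero_of_isZero_cechHomology hE' fun q => H I hI (q + 1) q.succ_pos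
  tfae_finish
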